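/- Let $l,k>1$ be integers. Let $\mathbb{Z}_l$ act on $\mathbb{R}^l$ and $\mathbb{Z}_k$ act on $\mathbb{R}^k$ by cyclic permutation of coordinates, and let $\Gamma=\mathbb{Z}_l\times\mathbb{Z}_k$ act on $\mathbb{R}^l\times\mathbb{R}^k$ by $(a,b)(x,y)=(ax,by)$. For $m\mid l$ and $n\mid k$ write $\mathbb{Z}_m\subseteq\mathbb{Z}_l$ and $\mathbb{Z}_n\subseteq\mathbb{Z}_k$ for the unique subgroups of orders $m$ and $n$. For a subgroup $K\subseteq\Gamma$ put $\mathrm{Fix}(K)=\{z: \gamma z=z \text{ for all }\gamma\in K\}$ and $L_K=\bigcup_{\gamma\notin K}\mathrm{Fix}(\gamma)\cap\mathrm{Fix}(K)$. A subgroup is an isotropy subgroup if it is the stabilizer of some point. For a subgroup $H\subseteq\Gamma$, an $H$-invariant subspace $V$ is called $H$-simple if either $V=W_1\oplus W_2$ with $W_1\cong W_2$ absolutely irreducible representations of $H$ (irreducible, with only the real scalars commuting with $H$), or $V$ is irreducible but not absolutely irreducible; $\ker_V(H)$ is the subgroup of those $h\in H$ that act trivially on $V$. A pair $(H,K)$ of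 subgroups $K\subseteq H\subseteq\Gamma$ is called Hopf-admissible (by the cyclic Hopf $H$ mod $K$ theorem) if it satisfies the seven conditions of that theorem: (a) $H/K$ is cyclic; (b) $K$ is an isotropy subgroup; (c) $\dim\mathrm{Fix}(K)\ge 2$, and if $\dim\mathrm{Fix}(K)=2$ then $H=K$ or $H=N(K)$, the normalizer of $K$ in $\Gamma$; (d) $H$ fixes (setwise) a connected component of $\mathrm{Fix}(K)\setminus L_K$; (e) $H$ is cyclic and is an isotropy subgroup; (f) there is an $H$-simple subspace $V\subseteq\mathbb{R}^l\times\mathbb{R}^k$ with $K=\ker_V(H)$; (g) $K$ is cyclic. Then the Hopf-admissible pairs $(H,K)$ in $\Gamma$ are exactly the following: (1) $(\mathbb{Z}_m\times\mathbb{Z}_n,\ \mathbb{Z}_m\times\mathbb{Z}_q)$, where $m\mid l$, $n\mid k$ and $q\mid n$, except when $q=k/2$ and $n=k$; here $m$ and $n$ are coprime, and $m$ and $q$ are coprime, with $m\ne q$ unless $m=q=1$; (2) $(\mathbb{Z}_m\times\mathbb{Z}_n,\ \mathbb{Z}_p\times\mathbb{Z}_n)$, where $m\mid l$, $n\mid k$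 and $p\mid m$, except when $p=l/2$ and $m=l$; here $m$ and $n$ are coprime, and $p$ and $n$ are coprime, with $p\ne n$ unless $p=n=1$. -/

import Mathlib

namespace CyclicHopf

section General

variable {G E : Type*} [Group G] [AddCommGroup E] [Module ℝ E]

/-- The isotropy subgroup of the point `x`: all group elements that fix `x`. -/
def isotropy (ρ : Representation ℝ G E) (x : E) : Subgroup G where
  carrier := {g | ρ g x = x}
  one_mem' := by simp
  mul_mem' := by
    intro a b ha hb
    simp only [Set.mem_ofPred_eq] at ha hb ⊢
    rw [map_mul, Module.End.mul_apply, hb, ha]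
  inv_mem' := by
    intro a ha
    simp only [Set.mem_ofPred_eq] at ha ⊢
    conv_lhs => rw [← ha]
    rw [← Module.End.mul_apply, ← map_mul, inv_mul_cancel, map_one, Module.End.one_apply]

/-- `K` is an isotropy subgroup: it is the isotropy subgroup of some point. -/
def IsIsotropySubgroup (ρ : Representation ℝ G E) (K : Subgroup G) : Prop :=
  ∃ x : E, isotropy ρ x = K

/-- The fixed-point subspace `Fix(K)`. -/
def fixedSpace (ρ : Representation ℝ G E) (K : Subgroup G) : Submodule ℝ E where
  carrier := {x | ∀ g ∈ K, ρ g x = x}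
  zero_mem' := by intro g _; simp
  add_mem' := by
    intro x y hx hy g hg
    rw [map_add, hx g hg, hy g hg]
  smul_mem' := by
    intro c x hx g hg
    rw [map_smul, hx g hg]

/-- The variety `L_K`, the union over `γ ∉ K` of `Fix(γ) ∩ Fix(K)`. -/
def varietyL (ρ : Representation ℝ G E) (K : Subgroup G) : Set E :=
  ⋃ γ ∈ {γ : G | γ ∉ K}, {x | ρ γ x = x} ∩ (fixedSpace ρ K : Set E)

/-- Some connected component of `Fix(K) ∖ L_K` is mapped onto itself by every element of `H`. -/
def FixesComponent [TopologicalSpace E] (ρ : Representation ℝ G E) (H K : Subgroup G) : Prop :=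
  ∃ x ∈ (fixedSpace ρ K : Set E) \ varietyL ρ K, ∀ h ∈ H,
    (ρ h) '' connectedComponentIn ((fixedSpace ρ K : Set E) \ varietyL ρ K) x =
      connectedComponentIn ((fixedSpace ρ K : Set E) \ varietyL ρ K) x

/-- `K` is normal in `H` and the quotient group `H / K` is cyclic (used for `K ≤ H`). -/
def QuotientIsCyclic (H K : Subgroup G) : Prop :=
  ∃ _ : (K.subgroupOf H).Normal, IsCyclic (H ⧸ K.subgroupOf H)

/-- A real representation is absolutely irreducible if it is irreducible and the only linear maps
commuting with it are the real scalars. -/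
def IsAbsolutelyIrreducible (σ : Representation ℝ G E) : Prop :=
  σ.IsIrreducible ∧ ∀ f : σ.IntertwiningMap σ, ∃ c : ℝ, ∀ w : E, f w = c • w

/-- An invariant subspace `V` is simple if either it is the direct sum of two isomorphic absolutely
irreducible invariant subspaces, or it is irreducible but not absolutely irreducible. -/
def IsSimpleSubspace {σ : Representation ℝ G E} (V : Subrepresentation σ) : Prop :=
  (∃ W₁ W₂ : Subrepresentation σ, Disjoint W₁ W₂ ∧ W₁ ⊔ W₂ = V ∧
    IsAbsolutelyIrreducible W₁.toRepresentation ∧ IsAbsolutelyIrreducible W₂.toRepresentation ∧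
    Nonempty (W₁.toRepresentation.Equiv W₂.toRepresentation)) ∨
  (V.toRepresentation.IsIrreducible ∧ ¬ IsAbsolutelyIrreducible V.toRepresentation)

/-- The restriction of a representation to a subgroup `H`. -/
abbrev res (ρ : Representation ℝ G E) (H : Subgroup G) : Representation ℝ H E :=
  MonoidHom.comp ρ H.subtype

/-- The kernel `ker_V(H)` of the action of `H` on an `H`-invariant subspace `V`, as a subgroup of
the whole group. -/
def kernelOn {ρ : Representation ℝ G E} {H : Subgroup G} (V : Subrepresentation (res ρ H)) :
    Subgroup G :=
  (MonoidHom.ker V.toRepresentation).map H.subtype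

/-- The conditions (a)-(d) of the `H mod K` theorem for a pair `K ≤ H`. -/
structure HmodKConditions [TopologicalSpace E] (ρ : Representation ℝ G E) (H K : Subgroup G) :
    Prop where
  le : K ≤ H
  quotient_cyclic : QuotientIsCyclic H K
  isotropy_K : IsIsotropySubgroup ρ K
  two_le_dim : 2 ≤ Module.finrank ℝ (fixedSpace ρ K)
  of_dim_eq_two : Module.finrank ℝ (fixedSpace ρ K) = 2 →
    H = K ∨ H = Subgroup.normalizer (K : Set G)
  fixes_component : FixesComponent ρ H K

/-- The pair `(H, K)` is Hopf-admissible by the cyclic Hopf `H mod K` theorem: it satisfies the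
conditions (a)-(d) of the `H mod K` theorem, `H` is a cyclic isotropy subgroup, `K` is the kernel
of the action of `H` on some `H`-simple subspace, and `K` is cyclic. -/
structure CyclicHopfAdmissible [TopologicalSpace E] (ρ : Representation ℝ G E)
    (H K : Subgroup G) : Prop where
  hmodk : HmodKConditions ρ H K
  cyclic_H : IsCyclic H
  isotropy_H : IsIsotropySubgroup ρ H
  simple : ∃ V : Subrepresentation (res ρ H), IsSimpleSubspace V ∧ K = kernelOn V
  cyclic_K : IsCyclic K

end General

/-- The cyclic group of order `n`, written multiplicatively. -/
abbrev Cyc (n : ℕ) : Type := Multiplicative (ZMod n)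

/-- The cyclic group of order `n` acting on `ℝⁿ`, with coordinates indexed by `ZMod n`, by cyclic
permutation of the coordinates. -/
def cyclicRep (n : ℕ) : Representation ℝ (Cyc n) (ZMod n → ℝ) where
  toFun a :=
    { toFun := fun x i => x (i - a.toAdd)
      map_add' := fun _ _ => rfl
      map_smul' := fun _ _ => rfl }
  map_one' := by
    ext x i
    simp
  map_mul' a b := by
    apply LinearMap.ext
    intro x
    funext i
    simp [sub_sub]

/-- The action of the product of the cyclic groups of orders `l` and `k` on `ℝˡ × ℝᵏ`,
given by `(a, b) (x, y) = (a x, b y)`. -/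
def diagRep (l k : ℕ) : Representation ℝ (Cyc l × Cyc k) ((ZMod l → ℝ) × (ZMod k → ℝ)) where
  toFun g := (cyclicRep l g.1).prodMap (cyclicRep k g.2)
  map_one' := by
    apply LinearMap.ext
    intro x
    simp
  map_mul' a b := by
    apply LinearMap.ext
    intro x
    simp

/-- For `m ∣ n`, the subgroup of order `m` of the cyclic group of order `n`. -/
def cyclicSubgroup (n m : ℕ) : Subgroup (Cyc n) :=
  Subgroup.zpowers (Multiplicative.ofAdd ((n / m : ℕ) : ZMod n))

theorem card_cyclicSubgroup {n m : ℕ} (hn : n ≠ 0) (h : m ∣ n) :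
    Nat.card (cyclicSubgroup n m) = m := by
  rw [cyclicSubgroup, Nat.card_zpowers, orderOf_ofAdd_eq_addOrderOf, ZMod.addOrderOf_coe _ hn,
    Nat.gcd_eq_right (Nat.div_dvd_of_dvd h), Nat.div_div_self h hn]

end CyclicHopf

/-! A stabilizer in $\Gamma$ is a product $\mathbb{Z}_m\times\mathbb{Z}_n$, and it is cyclic exactly
when $\gcd(m,n)=1$.

Necessity: an $H$-simple $V$ has the same kernel as some irreducible $W\subseteq V$. Since
$W\cap(0\times\mathbb{R}^k)$ is invariant, it is $0$ or $W$, so one factor of $H$ acts trivially on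
$V$ and lies in $K$ (`le_kernel_of_isSimpleSubspace`). This gives the two families. In the
exceptional case $y_0-y_1$ (or $x_0-x_1$) never vanishes on points with isotropy $K$ and changes
sign under an element of $H$, so no component is fixed (`not_fixesComponent_of_neg`).

Sufficiency: if $q\ne k$ and $2q\ne k$, the $q$-th character of $\mathbb{Z}_k$ spans a real plane on
which $\mathbb{Z}_k$ acts with kernel $\mathbb{Z}_q$. Translating the punctured plane by an
$H$-fixed vector of the other factor gives a connected $H$-invariant set of points with isotropy
$K$, and forces $\dim\mathrm{Fix}(K)>2$. `cyclicHopfAdmissible_of_planar` turns this into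
admissibility; the remaining case is $H=K$. -/

namespace CyclicHopf

/-! ### Isotropy strata, kernels and simple subspaces. -/

section General

variable {G E : Type*} [Group G] [AddCommGroup E] [Module ℝ E]

theorem mem_isotropy {ρ : Representation ℝ G E} {x : E} {g : G} :
    g ∈ isotropy ρ x ↔ ρ g x = x := Iff.rfl

/-- Deleting $L_K$ removes the points with stabilizer larger than $K$. All component arguments use
this description. -/
theorem mem_fixedSpace_diff_varietyL {ρ : Representation ℝ G E} {K : Subgroup G} {x : E} :
    x ∈ (fixedSpace ρ K : Set E) \ varietyL ρ K ↔ isotropy ρ x = K := by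
  simp only [varietyL, Set.mem_sdiff, SetLike.mem_coe, Set.mem_iUnion, Set.mem_inter_iff,
    Set.mem_ofPred_eq, not_exists, not_and]
  constructor
  · rintro ⟨h1, h2⟩
    ext g
    refine ⟨fun hg => ?_, fun hg => h1 g hg⟩
    by_contra hgK
    exact h2 g hgK hg h1
  · rintro rfl
    exact ⟨fun g hg => hg, fun g hg hg' => absurd hg' hg⟩

theorem mem_kernelOn {ρ : Representation ℝ G E} {H : Subgroup G}
    {V : Subrepresentation (res ρ H)} {g : G} :
    g ∈ kernelOn V ↔ g ∈ H ∧ ∀ v ∈ V.toSubmodule, ρ g v = v := by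
  simp only [kernelOn, Subgroup.mem_map, MonoidHom.mem_ker, Subgroup.subtype_apply]
  constructor
  · rintro ⟨h, hh, rfl⟩
    refine ⟨h.2, fun v hv => ?_⟩
    have := congrArg Subtype.val (LinearMap.congr_fun hh ⟨v, hv⟩)
    exact this
  · rintro ⟨hg, hv⟩
    refine ⟨⟨g, hg⟩, ?_, rfl⟩
    ext v
    exact hv v v.2

theorem isAbsolutelyIrreducible_of_finrank_eq_one {σ : Representation ℝ G E}
    (h : Module.finrank ℝ E = 1) : IsAbsolutelyIrreducible σ := by
  have hs : IsSimpleModule ℝ E := isSimpleModule_iff_finrank_eq_one.2 h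
  have := hs.toIsSimpleOrder
  refine ⟨?_, fun f => ?_⟩
  · have hn : Nontrivial (Subrepresentation σ) := by
      refine ⟨⊥, ⊤, fun he => ?_⟩
      exact bot_ne_top (α := Submodule ℝ E) (congrArg Subrepresentation.toSubmodule he)
    refine { toNontrivial := hn, eq_bot_or_eq_top := fun S => ?_ }
    rcases eq_bot_or_eq_top S.toSubmodule with hS | hS
    · exact Or.inl (Subrepresentation.toSubmodule_injective hS)
    · exact Or.inr (Subrepresentation.toSubmodule_injective hS)
  · obtain ⟨v, hv, hv'⟩ := finrank_eq_one_iff'.1 h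
    obtain ⟨c, hc⟩ := hv' (f v)
    refine ⟨c, fun w => ?_⟩
    obtain ⟨d, rfl⟩ := hv' w
    have : f (d • v) = d • f v := map_smul f.toLinearMap d v
    rw [this, ← hc, smul_comm]

/-- The line through an eigenvector as a subrepresentation. -/
def lineSubrep {σ : Representation ℝ G E} (v : E) (r : G → ℝ) (hr : ∀ g, σ g v = r g • v) :
    Subrepresentation σ where
  toSubmodule := Submodule.span ℝ {v}
  apply_mem_toSubmodule g w hw := by
    obtain ⟨a, rfl⟩ := Submodule.mem_span_singleton.1 hw
    rw [map_smul, hr]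
    exact Submodule.smul_mem _ _ (Submodule.smul_mem _ _ (Submodule.mem_span_singleton_self v))

theorem lineSubrep_apply {σ : Representation ℝ G E} {v : E} {r : G → ℝ}
    (hr : ∀ g, σ g v = r g • v) (g : G) {w : E} (hw : w ∈ (lineSubrep v r hr).toSubmodule) :
    σ g w = r g • w := by
  obtain ⟨a, rfl⟩ := Submodule.mem_span_singleton.1 hw
  rw [map_smul, hr, smul_comm]

theorem isSimpleSubspace_of_lines {σ : Representation ℝ G E} {v w : E} {r : G → ℝ}
    (hv : ∀ g, σ g v = r g • v) (hw : ∀ g, σ g w = r g • w) (hv0 : v ≠ 0) (hw0 : w ≠ 0)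
    (hvw : Disjoint (Submodule.span ℝ {v}) (Submodule.span ℝ {w})) (V : Subrepresentation σ)
    (hV : V.toSubmodule = Submodule.span ℝ {v} ⊔ Submodule.span ℝ {w}) : IsSimpleSubspace V := by
  have h1 : Module.finrank ℝ (lineSubrep v r hv).toSubmodule = 1 := finrank_span_singleton hv0
  have h2 : Module.finrank ℝ (lineSubrep w r hw).toSubmodule = 1 := finrank_span_singleton hw0
  refine Or.inl ⟨lineSubrep v r hv, lineSubrep w r hw, ?_, ?_,
    isAbsolutelyIrreducible_of_finrank_eq_one h1, isAbsolutelyIrreducible_of_finrank_eq_one h2, ?_⟩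
  · rw [disjoint_iff]
    exact Subrepresentation.toSubmodule_injective hvw.eq_bot
  · exact Subrepresentation.toSubmodule_injective hV.symm
  · have e := ((LinearEquiv.toSpanNonzeroSingleton ℝ E v hv0).symm.trans
      (LinearEquiv.toSpanNonzeroSingleton ℝ E w hw0))
    change (lineSubrep v r hv).toSubmodule ≃ₗ[ℝ] (lineSubrep w r hw).toSubmodule at e
    refine ⟨Representation.Equiv.mk e fun g => ?_⟩
    ext x
    have hx : (lineSubrep v r hv).toRepresentation g x = r g • x :=
      Subtype.ext (lineSubrep_apply hv g x.2)
    have hy : (lineSubrep w r hw).toRepresentation g (e x) = r g • e x :=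
      Subtype.ext (lineSubrep_apply hw g (e x).2)
    simp only [LinearMap.comp_apply, LinearEquiv.coe_coe]
    rw [hx, hy, map_smul]

/-- The image of an equivariant map from `ℂ`, on which the group acts by complex scalars. -/
noncomputable def planarSubrep {σ : Representation ℝ G E} (φ : ℂ →ₗ[ℝ] E) (χ : G → ℂ)
    (h : ∀ g c, σ g (φ c) = φ (χ g * c)) : Subrepresentation σ where
  toSubmodule := LinearMap.range φ
  apply_mem_toSubmodule g w hw := by
    obtain ⟨c, rfl⟩ := hw
    exact ⟨_, (h g c).symm⟩

/-- If $\chi(g)$ is not real, $c$ and $\chi(g)c$ form a real basis of $\mathbb{C}$ for every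
$c\ne0$. -/
theorem isIrreducible_planarSubrep {σ : Representation ℝ G E} {φ : ℂ →ₗ[ℝ] E} {χ : G → ℂ}
    (h : ∀ g c, σ g (φ c) = φ (χ g * c)) (hφ : Function.Injective φ) {g : G}
    (hg : (χ g).im ≠ 0) : (planarSubrep φ χ h).toRepresentation.IsIrreducible := by
  set V := planarSubrep φ χ h
  have hmem (c : ℂ) : φ c ∈ V.toSubmodule := ⟨c, rfl⟩
  have hact (c : ℂ) : V.toRepresentation g ⟨φ c, hmem c⟩ = ⟨φ (χ g * c), hmem _⟩ :=
    Subtype.ext (h g c)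
  have hn : Nontrivial (Subrepresentation V.toRepresentation) := by
    refine ⟨⊥, ⊤, fun he => ?_⟩
    have h1 : (⟨φ 1, hmem 1⟩ : V.toSubmodule) ∈ (⊥ : Submodule ℝ V.toSubmodule) := by
      have : (⊥ : Submodule ℝ V.toSubmodule) = ⊤ := congrArg Subrepresentation.toSubmodule he
      rw [this]
      trivial
    have h2 : φ 1 = 0 := congrArg Subtype.val ((Submodule.mem_bot ℝ).1 h1)
    exact one_ne_zero (hφ (h2.trans (map_zero φ).symm))
  refine { toNontrivial := hn, eq_bot_or_eq_top := fun S => or_iff_not_imp_left.2 fun hS => ?_ }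
  have hS' : S.toSubmodule ≠ ⊥ := fun hb => hS (Subrepresentation.toSubmodule_injective hb)
  obtain ⟨⟨w, c, rfl⟩, hwS, hw0⟩ := Submodule.exists_mem_ne_zero_of_ne_bot hS'
  have hc : c ≠ 0 := by
    rintro rfl
    exact hw0 (Subtype.ext (map_zero φ))
  apply Subrepresentation.toSubmodule_injective
  refine eq_top_iff.2 ?_
  rintro ⟨_, d, rfl⟩ -
  have h1 : (⟨φ (χ g * c), hmem _⟩ : V.toSubmodule) ∈ S.toSubmodule := by
    rw [← hact]
    exact S.apply_mem_toSubmodule g hwS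
  -- The coefficients solve $d/c=a+b\,\chi(g)$; the imaginary part determines $b$.
  set b : ℝ := (d / c).im / (χ g).im
  set a : ℝ := (d / c).re - b * (χ g).re
  have hd : d = a • c + b • (χ g * c) := by
    have : d / c = a + b * χ g := by
      apply Complex.ext
      · simp [a]
      · simp [b, hg]
    rw [div_eq_iff hc] at this
    rw [this, Complex.real_smul, Complex.real_smul]
    ring
  have hd' : (⟨φ d, hmem d⟩ : V.toSubmodule) =
      a • ⟨φ c, hmem c⟩ + b • ⟨φ (χ g * c), hmem _⟩ := by
    apply Subtype.ext
    change φ d = a • φ c + b • φ (χ g * c)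
    rw [← map_smul, ← map_smul, ← map_add, ← hd]
  change (⟨φ d, hmem d⟩ : V.toSubmodule) ∈ S.toSubmodule
  rw [hd']
  exact Submodule.add_mem _ (Submodule.smul_mem _ _ hwS) (Submodule.smul_mem _ _ h1)

/-- Multiplication by $i$ commutes with the action and is not a real scalar. -/
theorem not_isAbsolutelyIrreducible_planarSubrep {σ : Representation ℝ G E} {φ : ℂ →ₗ[ℝ] E}
    {χ : G → ℂ} (h : ∀ g c, σ g (φ c) = φ (χ g * c)) (hφ : Function.Injective φ) :
    ¬ IsAbsolutelyIrreducible (planarSubrep φ χ h).toRepresentation := by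
  rintro ⟨-, hf⟩
  let e : ℂ ≃ₗ[ℝ] (planarSubrep φ χ h).toSubmodule := LinearEquiv.ofInjective φ hφ
  have he (c : ℂ) : ((e c : (planarSubrep φ χ h).toSubmodule) : E) = φ c := rfl
  have hact (g : G) (c : ℂ) : (planarSubrep φ χ h).toRepresentation g (e c) = e (χ g * c) :=
    Subtype.ext (h g c)
  obtain ⟨a, ha⟩ := hf (LinearMap.intertwiningMap_of_isIntertwiningMap _ _
    (e.toLinearMap ∘ₗ LinearMap.mulLeft ℝ Complex.I ∘ₗ e.symm.toLinearMap) (by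
      intro g v
      obtain ⟨c, rfl⟩ := e.surjective v
      simp only [LinearMap.comp_apply, LinearEquiv.coe_coe, hact, e.symm_apply_apply,
        LinearMap.mulLeft_apply]
      congr 1
      ring))
  have h1 : e (Complex.I * e.symm (e 1)) = a • e 1 := ha (e 1)
  rw [e.symm_apply_apply, ← map_smul] at h1
  have h2 := congrArg Complex.im (e.injective h1)
  simp at h2

/-- The two alternatives of simplicity correspond to $\chi$ taking a nonreal value, or being real
and so splitting the plane into two isomorphic lines. -/
theorem isSimpleSubspace_planarSubrep {σ : Representation ℝ G E} {φ : ℂ →ₗ[ℝ] E} {χ : G → ℂ}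
    (h : ∀ g c, σ g (φ c) = φ (χ g * c)) (hφ : Function.Injective φ) :
    IsSimpleSubspace (planarSubrep φ χ h) := by
  by_cases hχ : ∃ g, (χ g).im ≠ 0
  · obtain ⟨g, hg⟩ := hχ
    exact Or.inr ⟨isIrreducible_planarSubrep h hφ hg, not_isAbsolutelyIrreducible_planarSubrep h hφ⟩
  · push Not at hχ
    have hact (c : ℂ) (g : G) : σ g (φ c) = (χ g).re • φ c := by
      rw [h, ← map_smul]
      congr 1
      apply Complex.ext <;> simp [hχ g]
    refine isSimpleSubspace_of_lines (v := φ 1) (w := φ Complex.I) (hact 1) (hact _)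
      (fun h0 => one_ne_zero (hφ (h0.trans (map_zero φ).symm)))
      (fun h0 => Complex.I_ne_zero (hφ (h0.trans (map_zero φ).symm))) ?_ _ ?_
    · rw [Submodule.disjoint_def]
      intro x hx hx'
      obtain ⟨a, rfl⟩ := Submodule.mem_span_singleton.1 hx
      obtain ⟨b, hb⟩ := Submodule.mem_span_singleton.1 hx'
      rw [← map_smul, ← map_smul] at hb
      have := congrArg Complex.re (hφ hb)
      simp at this
      simp [← this]
    · apply le_antisymm
      · rintro _ ⟨c, rfl⟩
        refine Submodule.mem_sup.2 ⟨c.re • φ 1, Submodule.smul_mem _ _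
          (Submodule.mem_span_singleton_self _), c.im • φ Complex.I, Submodule.smul_mem _ _
          (Submodule.mem_span_singleton_self _), ?_⟩
        rw [← map_smul, ← map_smul, ← map_add]
        congr 1
        apply Complex.ext <;> simp
      · rw [sup_le_iff, Submodule.span_singleton_le_iff_mem, Submodule.span_singleton_le_iff_mem]
        exact ⟨⟨1, rfl⟩, ⟨Complex.I, rfl⟩⟩

/-- For $V=W_1\oplus W_2$, the isomorphism carries triviality on $W_1$ over to $W_2$. -/
theorem exists_irreducible_of_isSimpleSubspace {σ : Representation ℝ G E}
    {V : Subrepresentation σ} (hV : IsSimpleSubspace V) :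
    ∃ W : Subrepresentation σ, W.toRepresentation.IsIrreducible ∧
      ∀ g, (∀ w ∈ W.toSubmodule, σ g w = w) → ∀ v ∈ V.toSubmodule, σ g v = v := by
  rcases hV with ⟨W₁, W₂, -, hsup, h1, -, ⟨e⟩⟩ | ⟨h, -⟩
  · refine ⟨W₁, h1.1, fun g hg v hv => ?_⟩
    rw [← hsup] at hv
    obtain ⟨a, ha, b, hb, rfl⟩ := Submodule.mem_sup.1 hv
    have h2 : σ g b = b := by
      obtain ⟨c, hc⟩ := e.toLinearEquiv.surjective ⟨b, hb⟩
      have hgc : W₁.toRepresentation g c = c := Subtype.ext (hg c c.2)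
      have := LinearMap.congr_fun (e.isIntertwining' g) c
      simp only [LinearMap.comp_apply] at this
      rw [hgc] at this
      have hc' : e.toLinearMap c = ⟨b, hb⟩ := hc
      rw [hc'] at this
      exact (congrArg Subtype.val this).symm
    rw [map_add, hg a ha, h2]
  · exact ⟨V, h, fun g hg => hg⟩

end General

/-! ### A planar criterion for admissibility, for abelian groups. -/

section Commutative

variable {G E : Type*} [CommGroup G] [AddCommGroup E] [Module ℝ E]

theorem isotropy_apply (ρ : Representation ℝ G E) (h : G) (x : E) :
    isotropy ρ (ρ h x) = isotropy ρ x := by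
  ext g
  rw [mem_isotropy, mem_isotropy, ← Module.End.mul_apply, ← map_mul, mul_comm, map_mul,
    Module.End.mul_apply]
  refine ⟨fun hg => ?_, fun hg => by rw [hg]⟩
  have := congrArg (ρ h⁻¹) hg
  rwa [Representation.inv_self_apply, Representation.inv_self_apply] at this

variable [TopologicalSpace E]

/-- Each $h\in H$ maps the component of $x$ to a connected part of the stratum containing $hx$,
which $S$ joins to $x$. Applying this to $h^{-1}$ gives equality. -/
theorem fixesComponent_of_isPreconnected {ρ : Representation ℝ G E} (hρ : ∀ g, Continuous (ρ g))
    {H K : Subgroup G} {S : Set E} (hS : IsPreconnected S) (hSK : ∀ x ∈ S, isotropy ρ x = K)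
    {x : E} (hx : x ∈ S) (hH : ∀ h ∈ H, ρ h x ∈ S) : FixesComponent ρ H K := by
  set U := (fixedSpace ρ K : Set E) \ varietyL ρ K
  have hU (y : E) : y ∈ U ↔ isotropy ρ y = K := mem_fixedSpace_diff_varietyL
  have hxU : x ∈ U := (hU x).2 (hSK x hx)
  have hSU : S ⊆ connectedComponentIn U x :=
    hS.subset_connectedComponentIn hx fun y hy => (hU y).2 (hSK y hy)
  have key (h : G) (hh : h ∈ H) :
      ρ h '' connectedComponentIn U x ⊆ connectedComponentIn U x := by
    conv_rhs => rw [connectedComponentIn_eq (hSU (hH h hh))]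
    refine IsPreconnected.subset_connectedComponentIn
      (isPreconnected_connectedComponentIn.image _ (hρ h).continuousOn)
      ⟨x, mem_connectedComponentIn hxU, rfl⟩ ?_
    rintro _ ⟨y, hy, rfl⟩
    rw [hU, isotropy_apply]
    exact (hU y).1 (connectedComponentIn_subset _ _ hy)
  refine ⟨x, hxU, fun h hh => (key h hh).antisymm fun y hy => ?_⟩
  exact ⟨ρ h⁻¹ y, key h⁻¹ (inv_mem hh) ⟨y, hy, rfl⟩, Representation.self_inv_apply ρ h y⟩

theorem quotientIsCyclic_of_isCyclic {H K : Subgroup G} (hH : IsCyclic H) :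
    QuotientIsCyclic H K :=
  ⟨inferInstance, isCyclic_of_surjective (QuotientGroup.mk' (K.subgroupOf H))
    (QuotientGroup.mk'_surjective _)⟩

/-- The two ways in which the component condition and the dimension condition are met: either
`H = K`, or a fixed vector `x₀` outside the plane of `φ` shifts the punctured plane into the set of
points with isotropy `K`. -/
theorem cyclicHopfAdmissible_of_planar [FiniteDimensional ℝ E] [ContinuousAdd E]
    {ρ : Representation ℝ G E} (hρ : ∀ g, Continuous (ρ g)) {H K : Subgroup G}
    (hcyc : IsCyclic H) (hHiso : IsIsotropySubgroup ρ H) (hKiso : IsIsotropySubgroup ρ K)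
    {φ : ℂ →ₗ[ℝ] E} (hφ : Function.Injective φ) (hφc : Continuous φ) {χ : G → ℂ}
    (hχ : ∀ h ∈ H, ∀ c, ρ h (φ c) = φ (χ h * c)) (hχ0 : ∀ h ∈ H, χ h ≠ 0)
    (hK : ∀ g, g ∈ K ↔ g ∈ H ∧ χ g = 1)
    (hcomp : H = K ∨ ∃ x₀ : E, (∀ h ∈ H, ρ h x₀ = x₀) ∧ x₀ ∉ LinearMap.range φ ∧
      ∀ c ≠ 0, isotropy ρ (x₀ + φ c) = K) :
    CyclicHopfAdmissible ρ H K := by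
  have hle : K ≤ H := fun g hg => ((hK g).1 hg).1
  have hφK (c : ℂ) : φ c ∈ fixedSpace ρ K := fun g hg => by
    rw [hχ g (hle hg), ((hK g).1 hg).2, one_mul]
  have hrange : LinearMap.range φ ≤ fixedSpace ρ K := by
    rintro _ ⟨c, rfl⟩
    exact hφK c
  have hdim : Module.finrank ℝ (LinearMap.range φ) = 2 := by
    rw [LinearMap.finrank_range_of_inj hφ, Complex.finrank_real_complex]
  refine ⟨⟨hle, quotientIsCyclic_of_isCyclic hcyc, hKiso, ?_, ?_, ?_⟩, hcyc, hHiso, ?_, ?_⟩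
  · rw [← hdim]
    exact Submodule.finrank_mono hrange
  · intro h2
    rcases hcomp with h | ⟨x₀, hx₀, hx₀φ, -⟩
    · exact Or.inl h
    -- Dimension two would make $\mathrm{Fix}(K)$ the plane itself, but $x_0\in\mathrm{Fix}(K)$ lies
    -- outside it.
    · have := Submodule.eq_of_le_of_finrank_eq hrange (hdim.trans h2.symm)
      exact absurd (this ▸ fun g hg => hx₀ g (hle hg)) hx₀φ
  · rcases hcomp with rfl | ⟨x₀, hx₀, -, hiso⟩
    · obtain ⟨x, rfl⟩ := hKiso
      exact fixesComponent_of_isPreconnected hρ (isPreconnected_singleton (x := x))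
        (by rintro _ rfl; rfl) rfl fun h hh => hh
    · refine fixesComponent_of_isPreconnected hρ (S := (fun c => x₀ + φ c) '' {0}ᶜ)
        (x := x₀ + φ 1) ?_ ?_ ⟨1, one_ne_zero, rfl⟩ fun h hh => ⟨χ h, hχ0 h hh, ?_⟩
      · refine IsPreconnected.image ?_ _ (continuous_const.add hφc).continuousOn
        exact (isConnected_compl_singleton_of_one_lt_rank
          (by rw [Complex.rank_real_complex]; norm_num) 0).isPreconnected
      · rintro _ ⟨c, hc, rfl⟩
        exact hiso c hc
      · simp only [map_add, hx₀ h hh, hχ h hh, mul_one]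
  · have hχ' (h : H) (c : ℂ) : res ρ H h (φ c) = φ (χ h * c) := hχ h h.2 c
    refine ⟨planarSubrep φ (fun h : H => χ h) hχ', isSimpleSubspace_planarSubrep hχ' hφ, ?_⟩
    ext g
    rw [hK, mem_kernelOn]
    refine and_congr_right fun hg => ⟨fun h1 v hv => ?_, fun hv => ?_⟩
    · obtain ⟨c, rfl⟩ := hv
      rw [hχ g hg, h1, one_mul]
    · have := hv (φ 1) ⟨1, rfl⟩
      rw [hχ g hg] at this
      simpa using hφ this
  · exact Subgroup.isCyclic_of_le hle

end Commutative

/-! ### Subgroups, isotropy and character planes of a single cyclic group. -/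

section Cyclic

/-- Used twice: to detect when the $q$-th character is real, and to show that $q\mid n\mid k=2q$
with $q\ne n$ forces $n=k$. -/
theorem eq_of_dvd_of_dvd_two_mul {n q : ℕ} (hq : 0 < q) (hqn : q ∣ n) (hne : q ≠ n)
    (hn : n ∣ 2 * q) : n = 2 * q := by
  obtain ⟨t, rfl⟩ := hqn
  have ht : t ∣ 2 := Nat.dvd_of_mul_dvd_mul_left hq (by rwa [mul_comm q 2])
  rcases (Nat.dvd_prime Nat.prime_two).1 ht with rfl | rfl
  · exact absurd (mul_one q).symm hne
  · exact mul_comm q 2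

theorem mem_cyclicSubgroup {n m : ℕ} (hn : n ≠ 0) (h : m ∣ n) (a : Cyc n) :
    a ∈ cyclicSubgroup n m ↔ (m : ZMod n) * a.toAdd = 0 := by
  have : NeZero n := ⟨hn⟩
  obtain ⟨d, rfl⟩ := h
  have hm : 0 < m := Nat.pos_of_ne_zero (left_ne_zero_of_mul hn)
  rw [cyclicSubgroup, Subgroup.mem_zpowers_iff, Nat.mul_div_cancel_left _ hm]
  constructor
  · rintro ⟨z, rfl⟩
    rw [toAdd_zpow, toAdd_ofAdd, zsmul_eq_mul, mul_left_comm, ← Nat.cast_mul,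
      ZMod.natCast_self, mul_zero]
  · intro ha
    rw [← ZMod.natCast_zmod_val a.toAdd, ← Nat.cast_mul, ZMod.natCast_eq_zero_iff] at ha
    obtain ⟨t, ht⟩ := Nat.dvd_of_mul_dvd_mul_left hm ha
    refine ⟨t, Multiplicative.toAdd.injective ?_⟩
    rw [toAdd_zpow, toAdd_ofAdd, zsmul_eq_mul, Int.cast_natCast, ← Nat.cast_mul,
      mul_comm t d, ← ht, ZMod.natCast_zmod_val]

theorem exists_eq_cyclicSubgroup {n : ℕ} (hn : n ≠ 0) (L : Subgroup (Cyc n)) :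
    ∃ m, m ∣ n ∧ L = cyclicSubgroup n m := by
  have : NeZero n := ⟨hn⟩
  have hd : Nat.card L ∣ n := by
    have := Subgroup.card_subgroup_dvd_card L
    rwa [Nat.card_congr Multiplicative.toAdd, Nat.card_zmod] at this
  refine ⟨Nat.card L, hd, Subgroup.eq_of_le_of_card_ge (fun a ha => ?_)
    (card_cyclicSubgroup hn hd).le⟩
  rw [mem_cyclicSubgroup hn hd, ← nsmul_eq_mul, ← toAdd_pow]
  have h1 : (⟨a, ha⟩ : L) ^ Nat.card L = 1 := pow_card_eq_one'
  have h2 : a ^ Nat.card L = 1 := congrArg Subtype.val h1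
  rw [h2, toAdd_one]

theorem cyclicSubgroup_self {n : ℕ} (hn : n ≠ 0) : cyclicSubgroup n n = ⊤ := by
  ext a
  simp [mem_cyclicSubgroup hn dvd_rfl]

theorem cyclicRep_apply {n : ℕ} (a : Cyc n) (x : ZMod n → ℝ) (i : ZMod n) :
    cyclicRep n a x i = x (i - a.toAdd) := rfl

open Classical in
/-- The indicator function of a subgroup. -/
noncomputable def subgroupIndicator {n : ℕ} (L : Subgroup (Cyc n)) : ZMod n → ℝ :=
  fun i => if Multiplicative.ofAdd i ∈ L then 1 else 0

theorem isotropy_subgroupIndicator {n : ℕ} (L : Subgroup (Cyc n)) :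
    isotropy (cyclicRep n) (subgroupIndicator L) = L := by
  ext a
  rw [mem_isotropy]
  constructor
  · intro h
    -- At coordinate $a$ the translated indicator takes its value at $0$, which is $1$.
    have := congrFun h a.toAdd
    simpa [cyclicRep_apply, subgroupIndicator] using this
  · intro ha
    funext i
    rw [cyclicRep_apply, subgroupIndicator, subgroupIndicator, ofAdd_sub, ofAdd_toAdd]
    congr 1
    exact propext ⟨fun h => by simpa using mul_mem h ha, fun h => div_mem h ha⟩

theorem subgroupIndicator_ne_zero {n : ℕ} (L : Subgroup (Cyc n)) : subgroupIndicator L ≠ 0 := by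
  intro h
  have := congrFun h 0
  simp [subgroupIndicator] at this

/-- The plane in `ℝⁿ` spanned by the real and imaginary parts of the `q`-th character. -/
noncomputable def characterPlane (n q : ℕ) [NeZero n] : ℂ →ₗ[ℝ] (ZMod n → ℝ) :=
  LinearMap.pi fun j => Complex.reLm ∘ₗ LinearMap.mulRight ℝ (ZMod.stdAddChar ((q : ZMod n) * j))

theorem characterPlane_apply (n q : ℕ) [NeZero n] (c : ℂ) (j : ZMod n) :
    characterPlane n q c j = (c * ZMod.stdAddChar ((q : ZMod n) * j)).re := rfl

theorem cyclicRep_characterPlane (n q : ℕ) [NeZero n] (a : Cyc n) (c : ℂ) :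
    cyclicRep n a (characterPlane n q c) =
      characterPlane n q (ZMod.stdAddChar (-((q : ZMod n) * a.toAdd)) * c) := by
  funext j
  rw [cyclicRep_apply, characterPlane_apply, characterPlane_apply, mul_sub, sub_eq_neg_add,
    AddChar.map_add_eq_mul]
  congr 1
  ring

theorem stdAddChar_neg_eq_one_iff {n q : ℕ} [NeZero n] (hq : q ∣ n) (a : Cyc n) :
    (ZMod.stdAddChar (-((q : ZMod n) * a.toAdd)) : ℂ) = 1 ↔ a ∈ cyclicSubgroup n q := by
  rw [mem_cyclicSubgroup (NeZero.ne n) hq, ← AddChar.map_zero_eq_one (ZMod.stdAddChar (N := n)),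
    ZMod.injective_stdAddChar.eq_iff, neg_eq_zero]

theorem stdAddChar_ne_zero {n : ℕ} [NeZero n] (j : ZMod n) : (ZMod.stdAddChar j : ℂ) ≠ 0 := by
  rw [ZMod.stdAddChar_apply]
  exact Circle.coe_ne_zero _

/-- Coordinate $0$ gives $\mathrm{Re}\,c=0$, and coordinate $1$ then gives
$\mathrm{Im}\,c\cdot\mathrm{Im}\,w=0$ for $w=e^{2\pi iq/n}$. A real $w$ of modulus one has $w^2=1$,
so $n\mid 2q$, which is excluded. -/
theorem characterPlane_injective {n q : ℕ} [NeZero n] (hq : q ∣ n) (h1 : q ≠ n)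
    (h2 : 2 * q ≠ n) : Function.Injective (characterPlane n q) := by
  rw [injective_iff_map_eq_zero]
  intro c hc
  have hre : c.re = 0 := by simpa [characterPlane_apply] using congrFun hc 0
  have him := congrFun hc 1
  simp only [characterPlane_apply, mul_one, Pi.zero_apply, Complex.mul_re, hre, zero_mul,
    zero_sub, neg_eq_zero, mul_eq_zero] at him
  refine Complex.ext hre (him.resolve_right fun him => ?_)
  set w : ℂ := ZMod.stdAddChar (q : ZMod n) with hw
  have hnorm : w.re * w.re + w.im * w.im = 1 := by
    rw [← Complex.normSq_apply, hw, ZMod.stdAddChar_apply, Circle.normSq_coe]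
  have hw2 : w * w = 1 := by
    apply Complex.ext
    · simp only [Complex.mul_re, Complex.one_re, him] at hnorm ⊢
      linarith
    · simp [him]
  rw [hw, ← AddChar.map_add_eq_mul, ← AddChar.map_zero_eq_one (ZMod.stdAddChar (N := n)),
    ZMod.injective_stdAddChar.eq_iff, ← Nat.cast_add, ZMod.natCast_eq_zero_iff] at hw2
  rw [← two_mul] at hw2
  exact h2 (eq_of_dvd_of_dvd_two_mul (Nat.pos_of_dvd_of_pos hq (NeZero.pos n)) hq h1 hw2).symm

theorem isotropy_characterPlane {n q : ℕ} [NeZero n] (hq : q ∣ n) (h1 : q ≠ n)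
    (h2 : 2 * q ≠ n) {c : ℂ} (hc : c ≠ 0) :
    isotropy (cyclicRep n) (characterPlane n q c) = cyclicSubgroup n q := by
  ext a
  rw [mem_isotropy, cyclicRep_characterPlane, (characterPlane_injective hq h1 h2).eq_iff,
    mul_eq_right₀ hc, stdAddChar_neg_eq_one_iff hq]

/-- A point of `ℝⁿ` whose isotropy subgroup has index two is determined by two distinct values,
which are exchanged by the generator. -/
theorem ne_and_swap_of_isotropy_eq {n q : ℕ} (hn : n ≠ 0) (hq : 2 * q = n) {y : ZMod n → ℝ}
    (hy : isotropy (cyclicRep n) y = cyclicSubgroup n q) :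
    y 0 - y 1 ≠ 0 ∧
      cyclicRep n (Multiplicative.ofAdd 1) y 0 - cyclicRep n (Multiplicative.ofAdd 1) y 1 =
        -(y 0 - y 1) := by
  have : NeZero n := ⟨hn⟩
  have hqn : q ∣ n := Dvd.intro_left 2 hq
  -- Since $2q=n$, the element $2$ lies in $\mathbb{Z}_q$, so $y$ is $2$-periodic.
  have h2 (i : ZMod n) : y (i - 2) = y i := by
    have : Multiplicative.ofAdd (2 : ZMod n) ∈ isotropy (cyclicRep n) y := by
      rw [hy, mem_cyclicSubgroup hn hqn, toAdd_ofAdd]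
      have : ((q * 2 : ℕ) : ZMod n) = 0 := by rw [mul_comm, hq, ZMod.natCast_self]
      exact_mod_cast this
    exact congrFun this i
  have hneg : y (-1) = y 1 := by
    rw [← h2 1]
    congr 1
    ring
  constructor
  · intro h01
    -- If $y_0=y_1$, periodicity makes $y$ constant; the generator would then fix $y$, giving $n\mid
    -- q$.
    have hall (t : ℕ) : y t = y 0 ∧ y (t + 1 : ℕ) = y 0 := by
      induction t with
      | zero => exact ⟨by simp, by simpa using (sub_eq_zero.1 h01).symm⟩
      | succ t ih =>
        refine ⟨ih.2, ?_⟩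
        rw [← ih.1, ← h2 (t + 1 + 1 : ℕ)]
        congr 1
        push_cast
        ring
    have hconst (i : ZMod n) : y i = y 0 := by
      rw [← ZMod.natCast_zmod_val i]
      exact (hall _).1
    have : Multiplicative.ofAdd (1 : ZMod n) ∈ isotropy (cyclicRep n) y := by
      rw [mem_isotropy]
      funext i
      rw [cyclicRep_apply, hconst, hconst i]
    rw [hy, mem_cyclicSubgroup hn hqn, toAdd_ofAdd, mul_one, ZMod.natCast_eq_zero_iff] at this
    have := Nat.le_of_dvd (by omega) this
    omega
  · rw [cyclicRep_apply, cyclicRep_apply, toAdd_ofAdd, sub_self, zero_sub, hneg]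
    ring

end Cyclic

/-! ### The product action: constructions and the kernel restriction. -/

section Diagonal

variable {l k : ℕ}

theorem diagRep_apply (g : Cyc l × Cyc k) (z : (ZMod l → ℝ) × (ZMod k → ℝ)) :
    diagRep l k g z = (cyclicRep l g.1 z.1, cyclicRep k g.2 z.2) := rfl

theorem continuous_diagRep (g : Cyc l × Cyc k) : Continuous (diagRep l k g) := by
  refine Continuous.prodMk ?_ ?_
  · refine continuous_pi fun i => ?_
    change Continuous fun z : (ZMod l → ℝ) × (ZMod k → ℝ) => z.1 (i - g.1.toAdd)
    fun_prop
  · refine continuous_pi fun i => ?_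
    change Continuous fun z : (ZMod l → ℝ) × (ZMod k → ℝ) => z.2 (i - g.2.toAdd)
    fun_prop

theorem isotropy_diagRep (x : ZMod l → ℝ) (y : ZMod k → ℝ) :
    isotropy (diagRep l k) (x, y) =
      (isotropy (cyclicRep l) x).prod (isotropy (cyclicRep k) y) := by
  ext g
  rw [mem_isotropy, Subgroup.mem_prod, mem_isotropy, mem_isotropy, diagRep_apply, Prod.mk.injEq]

theorem isIsotropySubgroup_prod (A : Subgroup (Cyc l)) (B : Subgroup (Cyc k)) :
    IsIsotropySubgroup (diagRep l k) (A.prod B) :=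
  ⟨(subgroupIndicator A, subgroupIndicator B), by
    rw [isotropy_diagRep, isotropy_subgroupIndicator, isotropy_subgroupIndicator]⟩

theorem exists_eq_prod_of_isIsotropySubgroup (hl : l ≠ 0) (hk : k ≠ 0)
    {L : Subgroup (Cyc l × Cyc k)} (h : IsIsotropySubgroup (diagRep l k) L) :
    ∃ m n, m ∣ l ∧ n ∣ k ∧ L = (cyclicSubgroup l m).prod (cyclicSubgroup k n) := by
  obtain ⟨⟨x, y⟩, rfl⟩ := h
  obtain ⟨m, hm, hm'⟩ := exists_eq_cyclicSubgroup hl (isotropy (cyclicRep l) x)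
  obtain ⟨n, hn, hn'⟩ := exists_eq_cyclicSubgroup hk (isotropy (cyclicRep k) y)
  exact ⟨m, n, hm, hn, by rw [isotropy_diagRep, hm', hn']⟩

theorem isCyclic_prod_cyclicSubgroup_iff (hl : l ≠ 0) (hk : k ≠ 0) {m n : ℕ} (hm : m ∣ l)
    (hn : n ∣ k) :
    IsCyclic ((cyclicSubgroup l m).prod (cyclicSubgroup k n)) ↔ Nat.Coprime m n := by
  rw [(Subgroup.prodEquiv _ _).isCyclic, Group.isCyclic_prod_iff, card_cyclicSubgroup hl hm,
    card_cyclicSubgroup hk hn]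
  exact ⟨fun h => h.2.2, fun h => ⟨inferInstance, inferInstance, h⟩⟩

/-- The plane spanned by the constant vectors of the two factors is fixed by all of $\Gamma$, so
$\chi=1$ serves. -/
theorem cyclicHopfAdmissible_self [NeZero l] [NeZero k] {H : Subgroup (Cyc l × Cyc k)}
    (hH : IsCyclic H) (hiso : IsIsotropySubgroup (diagRep l k) H) :
    CyclicHopfAdmissible (diagRep l k) H H := by
  let φ : ℂ →ₗ[ℝ] (ZMod l → ℝ) × (ZMod k → ℝ) :=
    (LinearMap.pi fun _ => Complex.reLm).prod (LinearMap.pi fun _ => Complex.imLm)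
  refine cyclicHopfAdmissible_of_planar continuous_diagRep hH hiso hiso (φ := φ) ?_
    (LinearMap.continuous_of_finiteDimensional φ) (χ := fun _ => 1) ?_
    (fun _ _ => one_ne_zero) (fun g => by simp) (Or.inl rfl)
  · intro c d h
    exact Complex.ext (congrFun (congrArg Prod.fst h) 0) (congrFun (congrArg Prod.snd h) 0)
  · intro h _ c
    rw [one_mul]
    rfl

theorem cyclicHopfAdmissible_right [NeZero l] [NeZero k] {A : Subgroup (Cyc l)} {n q : ℕ}
    (hn : n ∣ k) (hq : q ∣ n) (h1 : q ≠ k) (h2 : 2 * q ≠ k)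
    (hH : IsCyclic (A.prod (cyclicSubgroup k n))) :
    CyclicHopfAdmissible (diagRep l k) (A.prod (cyclicSubgroup k n))
      (A.prod (cyclicSubgroup k q)) := by
  have hqk := hq.trans hn
  have hk := NeZero.ne k
  refine cyclicHopfAdmissible_of_planar continuous_diagRep hH (isIsotropySubgroup_prod _ _)
    (isIsotropySubgroup_prod _ _) (φ := LinearMap.inr ℝ _ _ ∘ₗ characterPlane k q)
    (LinearMap.inr_injective.comp (characterPlane_injective hqk h1 h2))
    (LinearMap.continuous_of_finiteDimensional _)
    (χ := fun g => ZMod.stdAddChar (-((q : ZMod k) * g.2.toAdd))) ?_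
    -- The indicator of $A$ is fixed by $H$ and has stabilizer exactly $A$, so adding it cuts the
    -- isotropy down to $A\times\mathbb{Z}_q$.
    (fun _ _ => stdAddChar_ne_zero _) ?_ (Or.inr ⟨(subgroupIndicator A, 0), ?_, ?_, ?_⟩)
  · intro g _ c
    exact Prod.ext (map_zero (cyclicRep l g.1)) (cyclicRep_characterPlane k q g.2 c)
  · intro g
    rw [stdAddChar_neg_eq_one_iff hqk, Subgroup.mem_prod, Subgroup.mem_prod, and_assoc]
    refine and_congr_right fun _ => ⟨fun h => ⟨?_, h⟩, fun h => h.2⟩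
    rw [mem_cyclicSubgroup hk hqk] at h
    rw [mem_cyclicSubgroup hk hn]
    obtain ⟨t, rfl⟩ := hq
    rw [Nat.cast_mul, mul_right_comm, h, zero_mul]
  · intro g hg
    have := (Subgroup.mem_prod.1 hg).1
    rw [← isotropy_subgroupIndicator A] at this
    exact Prod.ext this (map_zero (cyclicRep k g.2))
  · rintro ⟨c, hc⟩
    exact subgroupIndicator_ne_zero A (congrArg Prod.fst hc).symm
  · intro c hc
    rw [LinearMap.comp_apply, LinearMap.inr_apply, Prod.mk_add_mk, add_zero, zero_add,
      isotropy_diagRep, isotropy_subgroupIndicator, isotropy_characterPlane hqk h1 h2 hc]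

theorem cyclicHopfAdmissible_left [NeZero l] [NeZero k] {B : Subgroup (Cyc k)} {m p : ℕ}
    (hm : m ∣ l) (hp : p ∣ m) (h1 : p ≠ l) (h2 : 2 * p ≠ l)
    (hH : IsCyclic ((cyclicSubgroup l m).prod B)) :
    CyclicHopfAdmissible (diagRep l k) ((cyclicSubgroup l m).prod B)
      ((cyclicSubgroup l p).prod B) := by
  have hpl := hp.trans hm
  have hl := NeZero.ne l
  refine cyclicHopfAdmissible_of_planar continuous_diagRep hH (isIsotropySubgroup_prod _ _)
    (isIsotropySubgroup_prod _ _) (φ := LinearMap.inl ℝ _ _ ∘ₗ characterPlane l p)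
    (LinearMap.inl_injective.comp (characterPlane_injective hpl h1 h2))
    (LinearMap.continuous_of_finiteDimensional _)
    (χ := fun g => ZMod.stdAddChar (-((p : ZMod l) * g.1.toAdd))) ?_
    (fun _ _ => stdAddChar_ne_zero _) ?_ (Or.inr ⟨(0, subgroupIndicator B), ?_, ?_, ?_⟩)
  · intro g _ c
    exact Prod.ext (cyclicRep_characterPlane l p g.1 c) (map_zero (cyclicRep k g.2))
  · intro g
    rw [stdAddChar_neg_eq_one_iff hpl, Subgroup.mem_prod, Subgroup.mem_prod, and_right_comm]
    refine and_congr_left fun _ => ⟨fun h => ⟨?_, h⟩, fun h => h.2⟩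
    rw [mem_cyclicSubgroup hl hpl] at h
    rw [mem_cyclicSubgroup hl hm]
    obtain ⟨t, rfl⟩ := hp
    rw [Nat.cast_mul, mul_right_comm, h, zero_mul]
  · intro g hg
    have := (Subgroup.mem_prod.1 hg).2
    rw [← isotropy_subgroupIndicator B] at this
    exact Prod.ext (map_zero (cyclicRep l g.1)) this
  · rintro ⟨c, hc⟩
    exact subgroupIndicator_ne_zero B (congrArg Prod.snd hc).symm
  · intro c hc
    rw [LinearMap.comp_apply, LinearMap.inl_apply, Prod.mk_add_mk, add_zero, zero_add,
      isotropy_diagRep, isotropy_subgroupIndicator, isotropy_characterPlane hpl h1 h2 hc]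

/-- The vectors of $W$ with zero first component form an invariant subspace. If it is all of $W$,
elements $(a,1)$ act trivially; if it is $0$, it contains $(1,b)w-w$, which therefore vanishes. -/
theorem acts_trivially_of_isIrreducible {H : Subgroup (Cyc l × Cyc k)}
    {W : Subrepresentation (res (diagRep l k) H)} (hW : W.toRepresentation.IsIrreducible) :
    (∀ a, (a, 1) ∈ H → ∀ w ∈ W.toSubmodule, diagRep l k (a, 1) w = w) ∨
      ∀ b, (1, b) ∈ H → ∀ w ∈ W.toSubmodule, diagRep l k (1, b) w = w := by
  let S : Subrepresentation W.toRepresentation :=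
    { toSubmodule := LinearMap.ker (LinearMap.fst ℝ (ZMod l → ℝ) (ZMod k → ℝ) ∘ₗ
        W.toSubmodule.subtype)
      apply_mem_toSubmodule := fun g w hw => by
        have hw' : w.1.1 = 0 := hw
        change cyclicRep l g.1.1 w.1.1 = 0
        rw [hw', map_zero] }
  have hS (w : W.toSubmodule) : w ∈ S.toSubmodule ↔ w.1.1 = 0 := Iff.rfl
  rcases hW.eq_bot_or_eq_top S with h | h
  · refine Or.inr fun b hb w hw => ?_
    have hd : diagRep l k (1, b) w - w ∈ W.toSubmodule :=
      sub_mem (W.apply_mem_toSubmodule ⟨(1, b), hb⟩ hw) hw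
    have h0 : (⟨_, hd⟩ : W.toSubmodule) ∈ S.toSubmodule := by
      rw [hS]
      simp [diagRep_apply]
    rw [h] at h0
    exact sub_eq_zero.1 (congrArg Subtype.val ((Submodule.mem_bot ℝ).1 h0))
  · refine Or.inl fun a ha w hw => ?_
    have h0 : (⟨w, hw⟩ : W.toSubmodule) ∈ S.toSubmodule := by
      rw [h]
      trivial
    rw [hS] at h0
    have h0' : w.1 = 0 := h0
    rw [diagRep_apply]
    refine Prod.ext ?_ ?_
    · simp [h0']
    · simp

theorem le_kernel_of_isSimpleSubspace {A K₁ : Subgroup (Cyc l)} {B K₂ : Subgroup (Cyc k)}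
    {V : Subrepresentation (res (diagRep l k) (A.prod B))} (hV : IsSimpleSubspace V)
    (hK : K₁.prod K₂ = kernelOn V) : A ≤ K₁ ∨ B ≤ K₂ := by
  obtain ⟨W, hW, hWV⟩ := exists_irreducible_of_isSimpleSubspace hV
  refine (acts_trivially_of_isIrreducible hW).imp (fun h a ha => ?_) fun h b hb => ?_
  · have haH : (a, 1) ∈ A.prod B := Subgroup.mem_prod.2 ⟨ha, one_mem _⟩
    have : (a, 1) ∈ K₁.prod K₂ := by
      rw [hK]
      exact mem_kernelOn.2 ⟨haH, hWV ⟨_, haH⟩ (h a haH)⟩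
    exact (Subgroup.mem_prod.1 this).1
  · have hbH : (1, b) ∈ A.prod B := Subgroup.mem_prod.2 ⟨one_mem _, hb⟩
    have : (1, b) ∈ K₁.prod K₂ := by
      rw [hK]
      exact mem_kernelOn.2 ⟨hbH, hWV ⟨_, hbH⟩ (h b hbH)⟩
    exact (Subgroup.mem_prod.1 this).2

end Diagonal

/-! ### A sign obstruction to fixing a component. -/

section Obstruction

variable {G E : Type*} [Group G] [AddCommGroup E] [Module ℝ E] [TopologicalSpace E]

/-- A fixed component would contain $x$ and $gx$, where $f$ has opposite signs; by connectedness $f$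
would vanish somewhere on it. -/
theorem not_fixesComponent_of_neg {ρ : Representation ℝ G E} {H K : Subgroup G} {f : E → ℝ}
    (hf : Continuous f) (hf0 : ∀ x, isotropy ρ x = K → f x ≠ 0) {g : G} (hg : g ∈ H)
    (hneg : ∀ x, isotropy ρ x = K → f (ρ g x) = -f x) : ¬ FixesComponent ρ H K := by
  rintro ⟨x, hx, h⟩
  set U := (fixedSpace ρ K : Set E) \ varietyL ρ K
  have hxC : x ∈ connectedComponentIn U x := mem_connectedComponentIn hx
  have hgC : ρ g x ∈ connectedComponentIn U x := by
    rw [← h g hg]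
    exact ⟨x, hxC, rfl⟩
  have hord := (isPreconnected_connectedComponentIn.image f hf.continuousOn).ordConnected
    (s := f '' connectedComponentIn U x)
  have hfg := hneg x (mem_fixedSpace_diff_varietyL.1 hx)
  have h0 : (0 : ℝ) ∈ f '' connectedComponentIn U x := by
    rcases le_total (f x) 0 with h' | h'
    · exact hord.out ⟨x, hxC, rfl⟩ ⟨_, hgC, rfl⟩ ⟨h', by linarith⟩
    · exact hord.out ⟨_, hgC, rfl⟩ ⟨x, hxC, rfl⟩ ⟨by linarith, h'⟩
  obtain ⟨y, hy, hy0⟩ := h0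
  exact hf0 y (mem_fixedSpace_diff_varietyL.1 (connectedComponentIn_subset _ _ hy)) hy0

end Obstruction

/-! ### The excluded index-two cases. -/

section Diagonal

variable {l k : ℕ}

theorem prod_inj {A A' : Subgroup (Cyc l)} {B B' : Subgroup (Cyc k)}
    (h : A.prod B = A'.prod B') : A = A' ∧ B = B' := by
  constructor
  · ext a
    simpa [Subgroup.mem_prod] using SetLike.ext_iff.1 h (a, 1)
  · ext b
    simpa [Subgroup.mem_prod] using SetLike.ext_iff.1 h (1, b)

theorem not_fixesComponent_right (hk : k ≠ 0) {q : ℕ} (hq : 2 * q = k) (A A' : Subgroup (Cyc l)) :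
    ¬ FixesComponent (diagRep l k) (A.prod (cyclicSubgroup k k))
      (A'.prod (cyclicSubgroup k q)) := by
  have key (z : (ZMod l → ℝ) × (ZMod k → ℝ))
      (hz : isotropy (diagRep l k) z = A'.prod (cyclicSubgroup k q)) :=
    ne_and_swap_of_isotropy_eq hk hq (prod_inj ((isotropy_diagRep z.1 z.2).symm.trans hz)).2
  refine not_fixesComponent_of_neg (f := fun z => z.2 0 - z.2 1) (by fun_prop)
    (fun z hz => (key z hz).1) (g := (1, Multiplicative.ofAdd 1)) ?_ fun z hz => (key z hz).2
  -- Here $n=k$ matters: $H$ must contain the generator of the second factor.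
  rw [cyclicSubgroup_self hk]
  exact Subgroup.mem_prod.2 ⟨one_mem _, trivial⟩

theorem not_fixesComponent_left (hl : l ≠ 0) {p : ℕ} (hp : 2 * p = l) (B B' : Subgroup (Cyc k)) :
    ¬ FixesComponent (diagRep l k) ((cyclicSubgroup l l).prod B)
      ((cyclicSubgroup l p).prod B') := by
  have key (z : (ZMod l → ℝ) × (ZMod k → ℝ))
      (hz : isotropy (diagRep l k) z = (cyclicSubgroup l p).prod B') :=
    ne_and_swap_of_isotropy_eq hl hp (prod_inj ((isotropy_diagRep z.1 z.2).symm.trans hz)).1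
  refine not_fixesComponent_of_neg (f := fun z => z.1 0 - z.1 1) (by fun_prop)
    (fun z hz => (key z hz).1) (g := (Multiplicative.ofAdd 1, 1)) ?_ fun z hz => (key z hz).2
  rw [cyclicSubgroup_self hl]
  exact Subgroup.mem_prod.2 ⟨trivial, one_mem _⟩

theorem dvd_of_cyclicSubgroup_le {n m q : ℕ} (hn : n ≠ 0) (hm : m ∣ n) (hq : q ∣ n)
    (h : cyclicSubgroup n q ≤ cyclicSubgroup n m) : q ∣ m := by
  have := Subgroup.card_dvd_of_le h
  rwa [card_cyclicSubgroup hn hm, card_cyclicSubgroup hn hq] at this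

end Diagonal

end CyclicHopf

/-! ### The classification. -/

theorem mainTheorem3 (l k : ℕ) (hl : 1 < l) (hk : 1 < k)
    (H K : Subgroup (CyclicHopf.Cyc l × CyclicHopf.Cyc k)) :
    CyclicHopf.CyclicHopfAdmissible (CyclicHopf.diagRep l k) H K ↔
      (∃ m n q : ℕ, m ∣ l ∧ n ∣ k ∧ q ∣ n ∧ ¬ (2 * q = k ∧ n = k) ∧
        Nat.Coprime m n ∧ Nat.Coprime m q ∧ (m ≠ q ∨ (m = 1 ∧ q = 1)) ∧
        H = (CyclicHopf.cyclicSubgroup l m).prod (CyclicHopf.cyclicSubgroup k n) ∧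
        K = (CyclicHopf.cyclicSubgroup l m).prod (CyclicHopf.cyclicSubgroup k q)) ∨
      (∃ m n p : ℕ, m ∣ l ∧ n ∣ k ∧ p ∣ m ∧ ¬ (2 * p = l ∧ m = l) ∧
        Nat.Coprime m n ∧ Nat.Coprime p n ∧ (p ≠ n ∨ (p = 1 ∧ n = 1)) ∧
        H = (CyclicHopf.cyclicSubgroup l m).prod (CyclicHopf.cyclicSubgroup k n) ∧
        K = (CyclicHopf.cyclicSubgroup l p).prod (CyclicHopf.cyclicSubgroup k n)) := by
  open CyclicHopf in
  have hl0 : l ≠ 0 := by omega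
  have hk0 : k ≠ 0 := by omega
  have : NeZero l := ⟨hl0⟩
  have : NeZero k := ⟨hk0⟩
  -- The inequality clauses of both families already follow from coprimality.
  have hne {a b : ℕ} (h : Nat.Coprime a b) : a ≠ b ∨ (a = 1 ∧ b = 1) := by
    by_cases hab : a = b
    · subst hab
      exact Or.inr ⟨(Nat.coprime_self a).1 h, (Nat.coprime_self a).1 h⟩
    · exact Or.inl hab
  constructor
  · rintro ⟨⟨hle, -, hKiso, -, -, hcomp⟩, hcyc, hHiso, ⟨V, hV, hVK⟩, -⟩
    obtain ⟨m, n, hm, hn, rfl⟩ := exists_eq_prod_of_isIsotropySubgroup hl0 hk0 hHiso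
    obtain ⟨p, q, hp, hq, rfl⟩ := exists_eq_prod_of_isIsotropySubgroup hl0 hk0 hKiso
    have hco := (isCyclic_prod_cyclicSubgroup_iff hl0 hk0 hm hn).1 hcyc
    have hle1 : cyclicSubgroup l p ≤ cyclicSubgroup l m := fun a ha =>
      (Subgroup.mem_prod.1 (hle (Subgroup.mem_prod (p := (a, 1)).2 ⟨ha, one_mem _⟩))).1
    have hle2 : cyclicSubgroup k q ≤ cyclicSubgroup k n := fun b hb =>
      (Subgroup.mem_prod.1 (hle (Subgroup.mem_prod (p := (1, b)).2 ⟨one_mem _, hb⟩))).2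
    have hpm := dvd_of_cyclicSubgroup_le hl0 hm hp hle1
    have hqn := dvd_of_cyclicSubgroup_le hk0 hn hq hle2
    rcases le_kernel_of_isSimpleSubspace hV hVK with h | h
    · have hmq := hco.coprime_dvd_right hqn
      refine Or.inl ⟨m, n, q, hm, hn, hqn, ?_, hco, hmq, hne hmq, rfl, by rw [h.antisymm hle1]⟩
      rintro ⟨h2, rfl⟩
      exact not_fixesComponent_right hk0 h2 _ _ hcomp
    · have hpn := hco.coprime_dvd_left hpm
      refine Or.inr ⟨m, n, p, hm, hn, hpm, ?_, hco, hpn, hne hpn, rfl, by rw [h.antisymm hle2]⟩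
      rintro ⟨h2, rfl⟩
      exact not_fixesComponent_left hl0 h2 _ _ hcomp
  · rintro (⟨m, n, q, hm, hn, hqn, hex, hco, -, -, rfl, rfl⟩ |
      ⟨m, n, p, hm, hn, hpm, hex, hco, -, -, rfl, rfl⟩)
    · have hcyc := (isCyclic_prod_cyclicSubgroup_iff hl0 hk0 hm hn).2 hco
      by_cases hqn' : q = n
      · subst hqn'
        exact cyclicHopfAdmissible_self hcyc (isIsotropySubgroup_prod _ _)
      · refine cyclicHopfAdmissible_right hn hqn ?_ ?_ hcyc
        · rintro rfl
          exact hqn' (hqn.antisymm hn)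
        · rintro rfl
          exact hex ⟨rfl, eq_of_dvd_of_dvd_two_mul (by omega) hqn hqn' hn⟩
    · have hcyc := (isCyclic_prod_cyclicSubgroup_iff hl0 hk0 hm hn).2 hco
      by_cases hpm' : p = m
      · subst hpm'
        exact cyclicHopfAdmissible_self hcyc (isIsotropySubgroup_prod _ _)
      · refine cyclicHopfAdmissible_left hm hpm ?_ ?_ hcyc
        · rintro rfl
          exact hpm' (hpm.antisymm hm)
        · rintro rfl
          exact hex ⟨rfl, eq_of_dvd_of_dvd_two_mul (by omega) hpm hpm' hm⟩
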